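/- Let $d\ge 1$ and $1\le\alpha<2$. Let $M:\mathbb R^d\to\mathbb R$ be twice differentiable with $M>0$, $M(-v)=M(v)$, $\int_{\mathbb R^d} M\,dv=1$, $|v|^{d+\alpha}M(v)\to\gamma$ as $|v|\to\infty$ for some $\gamma>0$, and $|D_vM(v)|\le C\frac{M(v)}{1+|v|}$, $|D_v^2M(v)|\le C\,M(v)$ for all $v$. Let $\sigma:\mathbb R^d\times\mathbb R^d\to\mathbb R$ satisfy, for some constants $0<\nu_1\le\nu_2$, $\nu_0$ and $C$ and all $v,v'\in\mathbb R^d$: $\sigma(v,v')=\sigma(v',v)$; $\nu_1\le\sigma(v,v')\le\nu_2$; $\sigma(v',\cdot)$ is differentiable with $|\nabla_v\sigma(v',v)|\le\frac{C}{1+|v|}$; $|\sigma(v,v')-\nu_0|\le\frac{C}{1+|v|}$; and the collision frequency $\nu(v)=\int\sigma(v',v)M(v')\,dv'$ is even. Set $$Q(f)(v)=\int_{\mathbb R^d}\big(\sigma(v,v')M(v)f(v')-\sigma(v',v)M(v')f(v)\big)\,dv'.$$ For a positive weight $w$, let $L^2_{w^{-1}}$ be the space of measurable $f$ with $\|f\|^2_{L^2_{w^{-1}}}=\int|f|^2\,\frac{dv}{w}<\infty$.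 For $E\in\mathbb R^d$ let $$T(f)=-Q(f)+E\cdot\nabla_v f,\qquad D(T)=\{f\in L^2_{M^{-1}}: E\cdot\nabla_v f\in L^2_{M^{-1}}\},$$ where $E\cdot\nabla_v f$ is taken in the sense of distributions, and let $F=F(\cdot,E)$ denote the positive solution in $L^2_{M^{-1}}$ of $$E\cdot\nabla_vF-Q(F)=0\ \text{ (in the sense of distributions)},\qquad \int_{\mathbb R^d}F\,dv=1$$ (the claims below hold for every such solution). Write $\rho_f=\int f\,dv$. Then, for all $E\in\mathbb R^d$ and all $f\in D(T)$, the function $T(f)\,f/F$ is integrable and $$\int_{\mathbb R^d}T(f)(v)\,\frac{f(v)}{F(v,E)}\,dv\ \ge\ 0.$$ Furthermore, for all $R>0$ there exists a constant $\theta(R)>0$ (which may depend on $d,\alpha,M,\sigma$ but not on $E$ or $f$) such that for all $|E|\le R$ and all $f\in D(T)$, the functions $f$ and $f-\rho_fF$ belong to $L^2_{F^{-1}}$ and $$\int_{\mathbb R^d}T(f)(v)\,\frac{f(v)}{F(v,E)}\,dv\ \ge\ \theta(R)\,\|f-\rho_fF\|^2_{L^2_{F^{-1}}(\mathbb R^d)}.$$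 -/

import Mathlib

open MeasureTheory Filter Topology Bornology
open scoped ContDiff

namespace LinearBoltzmann

/-- The velocity space `ℝ^d` with its Euclidean structure and Lebesgue measure `volume`. -/
abbrev Vel (d : ℕ) : Type := EuclideanSpace ℝ (Fin d)

variable {d : ℕ}

/-! ### Data of the linear Boltzmann operator -/

/-- The collision frequency `ν(v) = ∫ σ(v', v) M(v') dv'`. -/
noncomputable def collisionFrequency (M : Vel d → ℝ) (σ : Vel d → Vel d → ℝ) (v : Vel d) : ℝ :=
  ∫ v', σ v' v * M v'

/-- The assumptions on the thermodynamical equilibrium `M`: positive, even, normalized, with a heavy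
tail of order `d + α`, `1 ≤ α < 2`, and with decaying first and second derivatives. -/
structure IsHeavyTailed (α : ℝ) (M : Vel d → ℝ) : Prop where
  one_le : 1 ≤ α
  lt_two : α < 2
  pos : ∀ v, 0 < M v
  even : ∀ v, M (-v) = M v
  integral_eq_one : ∫ v, M v = 1
  tail : ∃ γ : ℝ, 0 < γ ∧ Tendsto (fun v => ‖v‖ ^ ((d : ℝ) + α) * M v) (cobounded (Vel d)) (𝓝 γ)
  differentiable : Differentiable ℝ M
  differentiable_fderiv : Differentiable ℝ (fderiv ℝ M)
  norm_fderiv_le : ∃ C : ℝ, ∀ v, ‖fderiv ℝ M v‖ ≤ C * (M v / (1 + ‖v‖))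
  norm_fderiv_fderiv_le : ∃ C : ℝ, ∀ v, ‖fderiv ℝ (fderiv ℝ M) v‖ ≤ C * M v

/-- The assumptions on the cross section `σ`: symmetric, bounded above and below by positive
constants, with decaying gradient in one velocity, even collision frequency, and a limit `ν₀` as
`|v| → ∞` with rate `1 / (1 + |v|)`. -/
structure IsCrossSection (M : Vel d → ℝ) (σ : Vel d → Vel d → ℝ) : Prop where
  symm : ∀ v v', σ v v' = σ v' v
  bounds : ∃ ν₁ ν₂ : ℝ, 0 < ν₁ ∧ ∀ v v', ν₁ ≤ σ v v' ∧ σ v v' ≤ ν₂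
  differentiable : ∀ v', Differentiable ℝ (fun v => σ v' v)
  norm_fderiv_le : ∃ C : ℝ, ∀ v' v, ‖fderiv ℝ (fun w => σ v' w) v‖ ≤ C / (1 + ‖v‖)
  even_frequency : ∀ v, collisionFrequency M σ (-v) = collisionFrequency M σ v
  limit : ∃ ν₀ C : ℝ, ∀ v v', |σ v v' - ν₀| ≤ C / (1 + ‖v‖)

/-- The linear Boltzmann operator
`Q(f)(v) = ∫ (σ(v, v') M(v) f(v') - σ(v', v) M(v') f(v)) dv'`. -/
noncomputable def collision (M : Vel d → ℝ) (σ : Vel d → Vel d → ℝ) (f : Vel d → ℝ)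
    (v : Vel d) : ℝ :=
  ∫ v', (σ v v' * M v * f v' - σ v' v * M v' * f v)

/-! ### Weighted spaces, mass density and weak derivatives -/

/-- `f` belongs to `L²_{w⁻¹}(ℝ^d)`, that is, `f` is measurable and `∫ |f|² / w dv < ∞`. -/
def MemL2Inv (w f : Vel d → ℝ) : Prop :=
  AEStronglyMeasurable f volume ∧ Integrable (fun v => |f v| ^ 2 / w v) volume

/-- The norm of `L²_{w⁻¹}(ℝ^d)`. -/
noncomputable def normL2Inv (w f : Vel d → ℝ) : ℝ :=
  Real.sqrt (∫ v, |f v| ^ 2 / w v)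

/-- The mass density `ρ_f = ∫ f dv`. -/
noncomputable def massDensity (f : Vel d → ℝ) : ℝ := ∫ v, f v

/-- `g = E · ∇_v f` in the sense of distributions on `ℝ^d`. -/
def HasWeakDirDeriv (E : Vel d) (f g : Vel d → ℝ) : Prop :=
  LocallyIntegrable f volume ∧ LocallyIntegrable g volume ∧
    ∀ φ : Vel d → ℝ, ContDiff ℝ ∞ φ → HasCompactSupport φ →
      ∫ v, f v * fderiv ℝ φ v E = - ∫ v, g v * φ v

open Classical in
/-- The function `E · ∇_v f` (unique up to null sets), when the distribution `E · ∇_v f` is a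
locally integrable function; `0` otherwise. -/
noncomputable def weakDirDeriv (E : Vel d) (f : Vel d → ℝ) : Vel d → ℝ :=
  if h : ∃ g, HasWeakDirDeriv E f g then h.choose else 0

/-! ### The operator `T` and the modified equilibrium `F` -/

/-- The operator `T(f) = -Q(f) + E · ∇_v f`. -/
noncomputable def transportCollision (M : Vel d → ℝ) (σ : Vel d → Vel d → ℝ) (E : Vel d)
    (f : Vel d → ℝ) (v : Vel d) : ℝ :=
  - collision M σ f v + weakDirDeriv E f v

/-- The domain of the unbounded operator `T`: those `f ∈ L²_{M⁻¹}` whose distributional derivative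
`E · ∇_v f` is again (a function) in `L²_{M⁻¹}`. -/
def InDomain (M : Vel d → ℝ) (E : Vel d) (f : Vel d → ℝ) : Prop :=
  MemL2Inv M f ∧ ∃ g, HasWeakDirDeriv E f g ∧ MemL2Inv M g

/-- `F = F(·, E)` is the modified equilibrium: the positive solution in `L²_{M⁻¹}` of
`E · ∇_v F - Q(F) = 0`, `∫ F dv = 1`. -/
structure IsModifiedEquilibrium (M : Vel d → ℝ) (σ : Vel d → Vel d → ℝ) (E : Vel d)
    (F : Vel d → ℝ) : Prop where
  memL2 : MemL2Inv M F
  pos : ∀ᵐ v, 0 < F v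
  equation : HasWeakDirDeriv E F (collision M σ F)
  integral_eq_one : ∫ v, F v = 1

end LinearBoltzmann

/-! Put `h = f / F`. Formally `(E · ∇f) h - ½ (E · ∇F) h² = ½ E · ∇(F h²)` is a divergence, so that
`∫ T(f) h = ½ ∫ Q(F) h² - ∫ Q(F h) h`, which the weak form of `Q` turns into the dissipation
`½ ∬ σ(v, v') M(v) F(v') (h(v) - h(v'))²`. As `σ ≥ ν₁`, and as the mean `ρ_f = ∫ h F` minimizes
`a ↦ ∫ F (h - a)²`, the dissipation is at least `(ν₁ / 2) ‖f - ρ_f F‖²`.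

The integration by parts needs no chain rule for weak derivatives. The translates of `f` and `F`
along `E` are `C¹` curves in `L¹`, and for `c` the truncation of `h` at height `n` the function
`s ↦ ∫ (2 c f(· + sE) - c² F(· + sE))` is maximal at `s = 0`, because pointwise `c` maximizes
`a ↦ 2 a f - a² F` over `|a| ≤ n`. Its derivative at `0` therefore vanishes; then `n → ∞`.

All integrals converge because `κ M ≤ F` for some `κ > 0`: from `E · ∇F = Q(F) ≥ ν₁ M - ν₂ F`,
Grönwall's inequality on the segment from `v - E` to `v` bounds `F(v)` below by a multiple of
`min M` on this segment, and `|∇M| ≤ C M` compares that minimum with `M(v)`.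
-/

namespace LinearBoltzmann

/-! ### Weak directional derivatives and translations -/

section

variable {d : ℕ} {E : Vel d} {f g : Vel d → ℝ}

theorem exists_clm_integral_mul {X : Type*} [MeasurableSpace X] {μ : Measure X} {ψ : X → ℝ}
    (hψ : MemLp ψ ⊤ μ) : ∃ L : Lp ℝ 1 μ →L[ℝ] ℝ, ∀ u, L u = ∫ x, ψ x * u x ∂μ := by
  refine ⟨(ContinuousLinearMap.mul ℝ ℝ).lpPairing μ ⊤ 1 (hψ.toLp ψ), fun u => ?_⟩
  rw [ContinuousLinearMap.lpPairing_eq_integral]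
  refine integral_congr_ae ?_
  filter_upwards [hψ.coeFn_toLp] with x hx
  rw [hx, ContinuousLinearMap.mul_apply']

theorem integral_mul_vadd_toL1 {V : Type*} [AddGroup V] [MeasurableSpace V] [MeasurableAdd V]
    {μ : Measure V} [μ.IsAddLeftInvariant] (ψ : V → ℝ) {f : V → ℝ} (hf : Integrable f μ) (x : V) :
    ∫ v, ψ v * (DomAddAct.mk x +ᵥ hf.toL1 f : Lp ℝ 1 μ) v ∂μ = ∫ v, ψ v * f (x + v) ∂μ := by
  refine integral_congr_ae ?_
  filter_upwards [DomAddAct.vadd_Lp_ae_eq (DomAddAct.mk x) (hf.toL1 f),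
    (measurePreserving_add_left μ x).quasiMeasurePreserving.ae_eq_comp hf.coeFn_toL1]
    with v hv hfv
  rw [hv]
  exact congrArg (ψ v * ·) hfv

theorem continuous_vadd_toL1 (E : Vel d) (hf : Integrable f) :
    Continuous fun s : ℝ => DomAddAct.mk (s • E) +ᵥ hf.toL1 f := by
  have : Fact ((1 : ENNReal) ≠ ⊤) := ⟨ENNReal.one_ne_top⟩
  have : Continuous fun s : ℝ => DomAddAct.mk (s • E) :=
    DomAddAct.continuous_mk.comp (by fun_prop)
  exact this.vadd continuous_const

theorem HasWeakDirDeriv.hasDerivAt_integral_test_translate (h : HasWeakDirDeriv E f g)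
    {φ : Vel d → ℝ} (hφ : ContDiff ℝ ∞ φ) (hφc : HasCompactSupport φ) (s : ℝ) :
    HasDerivAt (fun s : ℝ => ∫ v, φ v * f (s • E + v)) (∫ v, φ v * g (s • E + v)) s := by
  have shift (k : Vel d → ℝ) (s : ℝ) :
      ∫ v, φ v * k (s • E + v) = ∫ v, φ (v - s • E) * k v := by
    rw [← integral_add_left_eq_self (fun v => φ (v - s • E) * k v) (s • E)]
    simp only [add_sub_cancel_left]
  let L := ContinuousLinearMap.mul ℝ ℝ
  let η : Vel d → ℝ := φ ∘ Neg.neg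
  have hηd : ContDiff ℝ ∞ η := hφ.comp contDiff_neg
  have hηc : HasCompactSupport η := hφc.comp_homeomorph (Homeomorph.neg _)
  have hconv := (hηc.hasFDerivAt_convolution_right L h.1 (hηd.of_le (by simp))
    (s • E)).comp_hasDerivAt s ((hasDerivAt_id s).smul_const E)
  rw [one_smul, convolution_precompR_apply L h.1 (hηc.fderiv ℝ) (hηd.continuous_fderiv (by simp))]
    at hconv
  have hder (v : Vel d) : fderiv ℝ η (s • E - v) E = -fderiv ℝ φ (v - s • E) E := by
    have hφ' := (hφ.differentiable (by simp) (-(s • E - v))).hasFDerivAt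
    have := (hφ'.comp _ (hasFDerivAt_id (s • E - v)).neg).fderiv
    simpa [η] using congrArg (· E) this
  have htest := h.2.2 (fun v => φ (v - s • E)) (hφ.comp (by fun_prop))
      (hφc.comp_homeomorph (Homeomorph.subRight (s • E)))
  simp only [fderiv_comp_sub] at htest
  convert! hconv using 1
  · ext t
    simp only [shift, Function.comp_apply, id, convolution_def, L, η,
      ContinuousLinearMap.mul_apply', neg_sub, mul_comm]
  · simp only [shift, convolution_def, L, ContinuousLinearMap.mul_apply', hder, mul_neg,
      integral_neg, htest, neg_neg, mul_comm]

theorem HasWeakDirDeriv.vadd_toL1_eq (h : HasWeakDirDeriv E f g) (hf : Integrable f)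
    (hg : Integrable g) (s : ℝ) :
    DomAddAct.mk (s • E) +ᵥ hf.toL1 f =
      hf.toL1 f + ∫ r in (0 : ℝ)..s, DomAddAct.mk (r • E) +ᵥ hg.toL1 g := by
  have hgc := continuous_vadd_toL1 E hg
  refine Lp.ext (ae_eq_of_integral_contDiff_smul_eq (L1.integrable_coeFn _).locallyIntegrable
    (L1.integrable_coeFn _).locallyIntegrable fun φ hφ hφc => ?_)
  obtain ⟨L, hL⟩ := exists_clm_integral_mul
    (hφ.continuous.memLp_top_of_hasCompactSupport hφc (volume : Measure (Vel d)))
  have hLg : ∫ r in (0 : ℝ)..s, L (DomAddAct.mk (r • E) +ᵥ hg.toL1 g) =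
      L (DomAddAct.mk (s • E) +ᵥ hf.toL1 f) - L (DomAddAct.mk ((0 : ℝ) • E) +ᵥ hf.toL1 f) := by
    refine intervalIntegral.integral_eq_sub_of_hasDerivAt
      (f := fun r => L (DomAddAct.mk (r • E) +ᵥ hf.toL1 f)) (fun r _ => ?_)
      ((L.continuous.comp hgc).intervalIntegrable _ _)
    simp only [hL, integral_mul_vadd_toL1]
    exact h.hasDerivAt_integral_test_translate hφ hφc r
  simp only [smul_eq_mul]
  rw [← hL, ← hL, map_add, ← L.intervalIntegral_comp_comm (hgc.intervalIntegrable _ _), hLg,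
    zero_smul, DomAddAct.mk_zero, zero_vadd, add_sub_cancel]

theorem HasWeakDirDeriv.hasDerivAt_integral_mul_translate (h : HasWeakDirDeriv E f g)
    (hf : Integrable f) (hg : Integrable g) {ψ : Vel d → ℝ} (hψ : MemLp ψ ⊤ volume) (s : ℝ) :
    HasDerivAt (fun s : ℝ => ∫ v, ψ v * f (s • E + v)) (∫ v, ψ v * g (s • E + v)) s := by
  obtain ⟨L, hL⟩ := exists_clm_integral_mul hψ
  have hgc := continuous_vadd_toL1 E hg
  simp only [← integral_mul_vadd_toL1 ψ hf, ← integral_mul_vadd_toL1 ψ hg, ← hL,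
    h.vadd_toL1_eq hf hg]
  exact L.hasFDerivAt.comp_hasDerivAt s ((intervalIntegral.integral_hasDerivAt_right
    (hgc.intervalIntegrable _ _) (hgc.stronglyMeasurableAtFilter _ _)
    hgc.continuousAt).const_add _)

theorem HasWeakDirDeriv.hasDerivAt_setIntegral_translate (h : HasWeakDirDeriv E f g)
    (hf : Integrable f) (hg : Integrable g) {S : Set (Vel d)} (hS : MeasurableSet S) (s : ℝ) :
    HasDerivAt (fun s : ℝ => ∫ v in S, f (s • E + v)) (∫ v in S, g (s • E + v)) s := by
  have indicator_mul (k : Vel d → ℝ) :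
      ∫ v in S, k v = ∫ v, S.indicator (fun _ => 1) v * k v := by
    simp only [← Set.indicator_mul_left, one_mul, integral_indicator hS]
  simp only [indicator_mul]
  exact h.hasDerivAt_integral_mul_translate hf hg ((memLp_top_const 1).indicator hS) s

theorem mul_le_of_le_hasDerivAt_add_mul {y y' : ℝ → ℝ} {b m : ℝ} (hb : 0 < b)
    (hy : ∀ s, HasDerivAt y (y' s) s) (hy0 : 0 ≤ y (-1))
    (hm : ∀ s ∈ Set.Ico (-1 : ℝ) 0, m ≤ y' s + b * y s) : (1 - Real.exp (-b)) / b * m ≤ y 0 := by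
  have := le_gronwallBound_of_liminf_deriv_right_le (f := -y) (f' := -y') (δ := 0) (K := -b)
    (ε := -m) (a := -1) (b := 0) (fun s _ => (hy s).neg.continuousAt.continuousWithinAt)
    (fun s _ r hr => (hy s).neg.hasDerivWithinAt.liminf_right_slope_le hr) (by simpa using hy0)
    (fun s hs => by simp only [Pi.neg_apply]; linarith [hm s hs]) 0 (by simp)
  rw [gronwallBound_of_K_ne_0 (neg_ne_zero.2 hb.ne')] at this
  simp only [zero_mul, zero_add, neg_div_neg_eq, sub_neg_eq_add, mul_one, Pi.neg_apply] at this
  have sign : m / b * (Real.exp (-b) - 1) = -((1 - Real.exp (-b)) / b * m) := by ring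
  linarith

theorem HasWeakDirDeriv.ae_mul_le {m : Vel d → ℝ} {b : ℝ} (hb : 0 < b)
    (h : HasWeakDirDeriv E f g) (hf : Integrable f) (hg : Integrable g) (hm : Integrable m)
    (hf0 : 0 ≤ᵐ[volume] f)
    (hle : ∀ s ∈ Set.Ico (-1 : ℝ) 0, ∀ᵐ v, m v ≤ g (s • E + v) + b * f (s • E + v)) :
    ∀ᵐ v, (1 - Real.exp (-b)) / b * m v ≤ f v := by
  refine ae_le_of_forall_setIntegral_le (hm.const_mul _) hf fun S hS _ => ?_
  rw [integral_const_mul]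
  have key := mul_le_of_le_hasDerivAt_add_mul hb (h.hasDerivAt_setIntegral_translate hf hg hS)
    (m := ∫ v in S, m v) ?_ fun s hs => ?_
  · simpa only [zero_smul, zero_add] using key
  · exact setIntegral_nonneg_of_ae
      ((measurePreserving_add_left volume ((-1 : ℝ) • E)).quasiMeasurePreserving.ae hf0)
  · have hfs := (hf.comp_add_left (s • E)).const_mul b
    have hgs := hg.comp_add_left (s • E)
    rw [← integral_const_mul, ← integral_add hgs.integrableOn hfs.integrableOn]
    exact setIntegral_mono_ae hm.integrableOn (hgs.add hfs).integrableOn (hle s hs)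

theorem HasWeakDirDeriv.ae_eq {g' : Vel d → ℝ} (h : HasWeakDirDeriv E f g)
    (h' : HasWeakDirDeriv E f g') : g =ᵐ[volume] g' := by
  refine ae_eq_of_integral_contDiff_smul_eq h.2.1 h'.2.1 fun φ hφ hφc => ?_
  simpa only [smul_eq_mul, mul_comm (φ _), neg_inj] using
    (h.2.2 φ hφ hφc).symm.trans (h'.2.2 φ hφ hφc)

theorem HasWeakDirDeriv.weakDirDeriv_ae_eq (h : HasWeakDirDeriv E f g) :
    weakDirDeriv E f =ᵐ[volume] g := by
  have hex : ∃ g, HasWeakDirDeriv E f g := ⟨g, h⟩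
  rw [weakDirDeriv, dif_pos hex]
  exact hex.choose_spec.ae_eq h

end

/-! ### The weighted spaces -/

section

section Weighted

variable {X : Type*} [MeasurableSpace X] {μ : Measure X}

theorem integrable_mul_mul_of_sq {w h k : X → ℝ} (hw : AEStronglyMeasurable w μ)
    (hh : AEStronglyMeasurable h μ) (hk : AEStronglyMeasurable k μ)
    (hwh : Integrable (fun x => w x * h x ^ 2) μ) (hwk : Integrable (fun x => w x * k x ^ 2) μ) :
    Integrable (fun x => w x * (h x * k x)) μ := by
  refine (hwh.norm.add hwk.norm).mono' (hw.mul (hh.mul hk)) (ae_of_all _ fun x => ?_)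
  have young : |h x| * |k x| ≤ h x ^ 2 + k x ^ 2 := by
    nlinarith [sq_nonneg (|h x| - |k x|), sq_abs (h x), sq_abs (k x)]
  simp only [Real.norm_eq_abs, Pi.add_apply, abs_mul, abs_pow, sq_abs]
  rw [← mul_add]
  exact mul_le_mul_of_nonneg_left young (abs_nonneg _)

theorem integrable_mul_of_sq {w h : X → ℝ} (hw : Integrable w μ) (hh : AEStronglyMeasurable h μ)
    (hwh : Integrable (fun x => w x * h x ^ 2) μ) : Integrable (fun x => w x * h x) μ := by
  simpa only [Pi.one_apply, mul_one] using
    integrable_mul_mul_of_sq (k := 1) hw.1 hh aestronglyMeasurable_one hwh (by simpa using hw)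

end Weighted

variable {d : ℕ} {F f g w w' : Vel d → ℝ}

theorem memL2Inv_self (hw : Integrable w) : MemL2Inv w w :=
  ⟨hw.1, by simpa only [pow_two, abs_mul_abs_self, mul_self_div_self] using hw⟩

theorem MemL2Inv.integrable_mul_div (hw : AEStronglyMeasurable w volume) (hf : MemL2Inv w f)
    (hg : MemL2Inv w g) : Integrable fun v => f v * g v / w v := by
  have := integrable_mul_mul_of_sq (w := fun v => (w v)⁻¹) hw.inv₀ hf.1 hg.1
    (by simpa only [sq_abs, mul_comm, div_eq_mul_inv] using hf.2)
    (by simpa only [sq_abs, mul_comm, div_eq_mul_inv] using hg.2)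
  simpa only [mul_comm, div_eq_mul_inv] using this

theorem MemL2Inv.integrable (hw : Integrable w) (hw0 : ∀ᵐ v, w v ≠ 0) (hf : MemL2Inv w f) :
    Integrable f := by
  refine (hf.integrable_mul_div hw.1 (memL2Inv_self hw)).congr ?_
  filter_upwards [hw0] with v hv
  rw [mul_div_cancel_right₀ _ hv]

theorem MemL2Inv.of_mul_le {κ : ℝ} (hκ : 0 < κ) (hw : ∀ᵐ v, 0 < w v)
    (hw' : AEStronglyMeasurable w' volume) (hle : ∀ᵐ v, κ * w v ≤ w' v) (hf : MemL2Inv w f) :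
    MemL2Inv w' f := by
  refine ⟨hf.1, (hf.2.const_mul κ⁻¹).mono' ((hf.1.norm.pow 2).div₀ hw') ?_⟩
  filter_upwards [hw, hle] with v hv hv'
  have hκw : 0 < κ * w v := by positivity
  rw [Real.norm_of_nonneg (div_nonneg (by positivity) (hκw.le.trans hv'))]
  calc |f v| ^ 2 / w' v ≤ |f v| ^ 2 / (κ * w v) := by gcongr
    _ = κ⁻¹ * (|f v| ^ 2 / w v) := by field_simp

theorem normL2Inv_sq (hw : ∀ᵐ v, 0 < w v) : normL2Inv w f ^ 2 = ∫ v, |f v| ^ 2 / w v := by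
  refine Real.sq_sqrt (integral_nonneg_of_ae ?_)
  filter_upwards [hw] with v hv
  exact div_nonneg (sq_nonneg _) hv.le

theorem sub_const_mul_sq_div_ae_eq (hF : ∀ᵐ v, 0 < F v) (c : ℝ) :
    (fun v => |f v - c * F v| ^ 2 / F v) =ᵐ[volume]
      fun v => |f v| ^ 2 / F v + (c ^ 2 * F v - 2 * c * f v) := by
  filter_upwards [hF] with v hv
  rw [sq_abs, sq_abs]
  field_simp
  ring

theorem MemL2Inv.integrable_mul_div_sq (hf : MemL2Inv w f) :
    Integrable fun v => w v * (f v / w v) ^ 2 := by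
  refine hf.2.congr (ae_of_all _ fun v => ?_)
  rcases eq_or_ne (w v) 0 with hv | hv
  · simp only [hv, div_zero, zero_mul]
  · simp only [sq_abs]
    field_simp

theorem MemL2Inv.integrable_mul_div_sq_of_mul_le {κ : ℝ} (hκ : 0 < κ) (hf : MemL2Inv w f)
    (hw : AEStronglyMeasurable w volume) (hw' : AEStronglyMeasurable w' volume)
    (hw'0 : ∀ᵐ v, 0 ≤ w' v) (hle : ∀ᵐ v, κ * w' v ≤ w v) :
    Integrable fun v => w' v * (f v / w v) ^ 2 := by
  refine (hf.integrable_mul_div_sq.const_mul κ⁻¹).mono' (hw'.mul ((hf.1.div₀ hw).pow 2)) ?_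
  filter_upwards [hw'0, hle] with v h0 hv
  rw [Real.norm_of_nonneg (by positivity), ← mul_assoc]
  gcongr
  rwa [inv_mul_eq_div, le_div_iff₀' hκ]

section Normalized

variable (hF : Integrable F) (hFpos : ∀ᵐ v, 0 < F v) (hf : MemL2Inv F f) (c : ℝ)
include hF hFpos hf

theorem MemL2Inv.sub_const_mul : MemL2Inv F fun v => f v - c * F v := by
  have hfi := hf.integrable hF (hFpos.mono fun _ h => h.ne')
  exact ⟨hf.1.sub (hF.1.const_mul c), (hf.2.add ((hF.const_mul (c ^ 2)).sub
    (hfi.const_mul (2 * c)))).congr (sub_const_mul_sq_div_ae_eq hFpos c).symm⟩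

theorem MemL2Inv.normL2Inv_sub_const_mul_sq (hF1 : ∫ v, F v = 1) :
    normL2Inv F (fun v => f v - c * F v) ^ 2 =
      normL2Inv F f ^ 2 - massDensity f ^ 2 + (massDensity f - c) ^ 2 := by
  have hfc := (hf.integrable hF (hFpos.mono fun _ h => h.ne')).const_mul (2 * c)
  have hFc := hF.const_mul (c ^ 2)
  have hsub : Integrable fun v => c ^ 2 * F v - 2 * c * f v := hFc.sub hfc
  rw [normL2Inv_sq hFpos, normL2Inv_sq hFpos,
    integral_congr_ae (sub_const_mul_sq_div_ae_eq hFpos c),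
    integral_add hf.2 hsub, integral_sub hFc hfc, integral_const_mul,
    integral_const_mul, hF1, massDensity]
  ring

theorem MemL2Inv.normL2Inv_sub_massDensity_mul_sq_le (hF1 : ∫ v, F v = 1) :
    normL2Inv F (fun v => f v - massDensity f * F v) ^ 2 ≤
      normL2Inv F (fun v => f v - c * F v) ^ 2 := by
  simp only [hf.normL2Inv_sub_const_mul_sq hF hFpos _ hF1]
  linarith [sq_nonneg (massDensity f - c)]

end Normalized

end

/-! ### Integration by parts against a quotient -/

section

section Truncation

/-- Truncation to `[-n, n]`. It is only used with `0 ≤ n`, where it is the projection onto this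
interval. -/
noncomputable def truncate (n x : ℝ) : ℝ := max (-n) (min x n)

theorem continuous_truncate (n : ℝ) : Continuous (truncate n) := by
  unfold truncate
  fun_prop

theorem abs_truncate_le {n : ℝ} (hn : 0 ≤ n) (x : ℝ) : |truncate n x| ≤ n :=
  abs_le.2 ⟨le_max_left _ _, max_le (neg_le_self hn) (min_le_right _ _)⟩

theorem truncate_eq_self {n x : ℝ} (h : |x| ≤ n) : truncate n x = x := by
  rw [truncate, min_eq_left (abs_le.1 h).2, max_eq_right (abs_le.1 h).1]

theorem abs_truncate_le_abs {n : ℝ} (hn : 0 ≤ n) (x : ℝ) : |truncate n x| ≤ |x| := by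
  rcases le_total |x| n with h | h
  · rw [truncate_eq_self h]
  · exact (abs_truncate_le hn x).trans h

theorem two_mul_mul_sub_sq_le_truncate {n a : ℝ} (x : ℝ) (ha : |a| ≤ n) :
    2 * a * x - a ^ 2 ≤ 2 * truncate n x * x - truncate n x ^ 2 := by
  obtain ⟨ha₁, ha₂⟩ := abs_le.1 ha
  unfold truncate
  rcases le_total x n with hxn | hxn
  · rw [min_eq_left hxn]
    rcases le_total (-n) x with hnx | hnx
    · rw [max_eq_right hnx]
      nlinarith [sq_nonneg (a - x)]
    · rw [max_eq_left hnx]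
      nlinarith
  · rw [min_eq_right hxn, max_eq_right (by linarith)]
    nlinarith

variable {X : Type*} [MeasurableSpace X] {μ : Measure X} {f F : X → ℝ}

theorem memLp_truncate (hf : AEStronglyMeasurable f μ) {n : ℝ} (hn : 0 ≤ n) :
    MemLp (fun x => truncate n (f x)) ⊤ μ :=
  memLp_top_of_bound ((continuous_truncate n).comp_aestronglyMeasurable hf) n
    (ae_of_all _ fun _ => abs_truncate_le hn _)

theorem memLp_top_sq (hf : MemLp f ⊤ μ) : MemLp (fun x => f x ^ 2) ⊤ μ := by
  simp only [sq]
  exact hf.mul hf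

theorem tendsto_integral_truncate_pow_mul {u k : X → ℝ} (p : ℕ)
    (hu : AEStronglyMeasurable u μ) (hk : AEStronglyMeasurable k μ)
    (hi : Integrable (fun x => u x ^ p * k x) μ) :
    Tendsto (fun n : ℕ => ∫ x, truncate n (u x) ^ p * k x ∂μ) atTop
      (𝓝 (∫ x, u x ^ p * k x ∂μ)) := by
  refine tendsto_integral_of_dominated_convergence (fun x => ‖u x ^ p * k x‖)
    (fun n => (((continuous_truncate n).comp_aestronglyMeasurable hu).pow p).mul hk) hi.norm
    (fun n => ae_of_all _ fun x => ?_) (ae_of_all _ fun x => tendsto_const_nhds.congr' ?_)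
  · simp only [norm_mul, norm_pow, Real.norm_eq_abs]
    gcongr ?_ ^ p * _
    exact abs_truncate_le_abs n.cast_nonneg (u x)
  · filter_upwards [eventually_ge_atTop ⌈|u x|⌉₊] with n hn
    rw [truncate_eq_self (Nat.ceil_le.1 hn)]

theorem two_mul_integral_mul_sub_le_truncate (hf : Integrable f μ) (hF : Integrable F μ)
    (hF0 : ∀ᵐ v ∂μ, 0 < F v) {n : ℝ} (hn : 0 ≤ n) {a : X → ℝ} (ha : MemLp a ⊤ μ)
    (han : ∀ v, |a v| ≤ n) :
    2 * (∫ v, a v * f v ∂μ) - ∫ v, a v ^ 2 * F v ∂μ ≤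
      2 * (∫ v, truncate n (f v / F v) * f v ∂μ) -
        ∫ v, truncate n (f v / F v) ^ 2 * F v ∂μ := by
  have hc := memLp_truncate (hf.1.div₀ hF.1) hn
  have ha₁ : Integrable (fun v => 2 * (a v * f v)) μ := (hf.mul_of_top_right ha).const_mul 2
  have hc₁ : Integrable (fun v => 2 * (truncate n (f v / F v) * f v)) μ :=
    (hf.mul_of_top_right hc).const_mul 2
  have ha₂ : Integrable (fun v => a v ^ 2 * F v) μ := hF.mul_of_top_right (memLp_top_sq ha)
  have hc₂ : Integrable (fun v => truncate n (f v / F v) ^ 2 * F v) μ :=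
    hF.mul_of_top_right (memLp_top_sq hc)
  rw [← integral_const_mul, ← integral_const_mul, ← integral_sub ha₁ ha₂, ← integral_sub hc₁ hc₂]
  refine integral_mono_ae (ha₁.sub ha₂) (hc₁.sub hc₂) ?_
  filter_upwards [hF0] with v hv
  have factor (b : ℝ) : 2 * (b * f v) - b ^ 2 * F v = F v * (2 * b * (f v / F v) - b ^ 2) := by
    field_simp
  rw [factor, factor]
  exact mul_le_mul_of_nonneg_left (two_mul_mul_sub_sq_le_truncate _ (han v)) hv.le

end Truncation

variable {d : ℕ} {E : Vel d} {f g F G : Vel d → ℝ}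

section IntegrationByParts

variable (hf : Integrable f) (hg : Integrable g) (hfg : HasWeakDirDeriv E f g)
  (hF : Integrable F) (hG : Integrable G) (hFG : HasWeakDirDeriv E F G) (hF0 : ∀ᵐ v, 0 < F v)
include hf hg hfg hF hG hFG hF0

theorem HasWeakDirDeriv.two_mul_integral_truncate_div_mul {n : ℝ} (hn : 0 ≤ n) :
    2 * ∫ v, truncate n (f v / F v) * g v = ∫ v, truncate n (f v / F v) ^ 2 * G v := by
  set c : Vel d → ℝ := fun v => truncate n (f v / F v)
  have hc : MemLp c ⊤ volume := memLp_truncate (hf.1.div₀ hF.1) hn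
  let Ψ : ℝ → ℝ := fun s => 2 * (∫ v, c v * f (s • E + v)) - ∫ v, c v ^ 2 * F (s • E + v)
  have hΨ : HasDerivAt Ψ (2 * (∫ v, c v * g ((0 : ℝ) • E + v)) -
      ∫ v, c v ^ 2 * G ((0 : ℝ) • E + v)) 0 :=
    ((hfg.hasDerivAt_integral_mul_translate hf hg hc 0).const_mul 2).sub
      (hFG.hasDerivAt_integral_mul_translate hF hG (memLp_top_sq hc) 0)
  have hmax (s : ℝ) : Ψ s ≤ Ψ 0 := by
    have := two_mul_integral_mul_sub_le_truncate hf hF hF0 hn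
      (hc.comp_measurePreserving (measurePreserving_add_left volume (-(s • E))))
      fun v => abs_truncate_le hn _
    rw [← integral_add_left_eq_self (fun v => _ * f v) (s • E),
      ← integral_add_left_eq_self (fun v => _ * F v) (s • E)] at this
    simpa only [Ψ, Function.comp_apply, neg_add_cancel_left, zero_smul, zero_add] using this
  have := IsLocalMax.hasDerivAt_eq_zero (Eventually.of_forall hmax) hΨ
  simpa only [zero_smul, zero_add, sub_eq_zero] using this

theorem HasWeakDirDeriv.two_mul_integral_div_mul (hfgF : Integrable fun v => f v / F v * g v)
    (hfGF : Integrable fun v => (f v / F v) ^ 2 * G v) :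
    2 * ∫ v, f v / F v * g v = ∫ v, (f v / F v) ^ 2 * G v := by
  have hm : AEStronglyMeasurable (fun v => f v / F v) volume := hf.1.div₀ hF.1
  have lim_g := (tendsto_integral_truncate_pow_mul 1 hm hg.1 (by simpa only [pow_one])).const_mul 2
  have lim_G := tendsto_integral_truncate_pow_mul 2 hm hG.1 hfGF
  simp only [pow_one] at lim_g
  exact tendsto_nhds_unique lim_g (lim_G.congr fun n =>
    (hfg.two_mul_integral_truncate_div_mul hf hg hF hG hFG hF0 n.cast_nonneg).symm)

end IntegrationByParts

end

/-! ### The collision operator -/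

section

variable {d : ℕ} {M f ψ F h : Vel d → ℝ} {σ : Vel d → Vel d → ℝ}

theorem integrable_kernel_mul {u w : Vel d → ℝ} {C : ℝ} (hσ : Measurable (Function.uncurry σ))
    (hC : ∀ v v', |σ v v'| ≤ C) (hu : Integrable u) (hw : Integrable w) :
    Integrable (fun p : Vel d × Vel d => σ p.1 p.2 * (u p.1 * w p.2)) (volume.prod volume) :=
  (hu.mul_prod hw).bdd_mul hσ.aestronglyMeasurable (ae_of_all _ fun p => hC p.1 p.2)

section WeakForm

variable {C : ℝ} (hσ : Measurable (Function.uncurry σ)) (hC : ∀ v v', |σ v v'| ≤ C)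
  (hM : Integrable M) (hf : Integrable f) (hMψ : Integrable fun v => M v * ψ v)
  (hfψ : Integrable fun v => f v * ψ v)

theorem collision_mul_eq_integral (v : Vel d) :
    collision M σ f v * ψ v =
      ∫ v', (σ v v' * (M v * ψ v * f v') - σ v' v * (M v' * (f v * ψ v))) := by
  rw [collision, ← integral_mul_const]
  exact integral_congr_ae (ae_of_all _ fun v' => by ring)

include hσ hC hM hf hMψ hfψ

theorem integrable_collision_mul : Integrable fun v => collision M σ f v * ψ v := by
  simp only [collision_mul_eq_integral]
  exact ((integrable_kernel_mul hσ hC hMψ hf).sub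
    (integrable_kernel_mul hσ hC hM hfψ).swap).integral_prod_left

theorem integrable_collision_kernel :
    Integrable (fun p : Vel d × Vel d => σ p.1 p.2 * (M p.1 * f p.2) * (ψ p.1 - ψ p.2))
      (volume.prod volume) :=
  ((integrable_kernel_mul hσ hC hMψ hf).sub (integrable_kernel_mul hσ hC hM hfψ)).congr
    (ae_of_all _ fun p => by simp only [Pi.sub_apply]; ring)

theorem integral_collision_mul :
    ∫ v, collision M σ f v * ψ v = ∫ p : Vel d × Vel d,
      σ p.1 p.2 * (M p.1 * f p.2) * (ψ p.1 - ψ p.2) ∂volume.prod volume := by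
  have gain := integrable_kernel_mul hσ hC hMψ hf
  have loss := integrable_kernel_mul hσ hC hM hfψ
  calc ∫ v, collision M σ f v * ψ v
    _ = ∫ p : Vel d × Vel d, (σ p.1 p.2 * (M p.1 * ψ p.1 * f p.2) -
          σ p.2 p.1 * (M p.2 * (f p.1 * ψ p.1))) ∂volume.prod volume := by
        simp only [collision_mul_eq_integral]
        exact (integral_prod _ (gain.sub loss.swap)).symm
    _ = ∫ p : Vel d × Vel d, (σ p.1 p.2 * (M p.1 * ψ p.1 * f p.2) -
          σ p.1 p.2 * (M p.1 * (f p.2 * ψ p.2))) ∂volume.prod volume := by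
        rw [integral_sub gain loss, ← integral_prod_swap fun p : Vel d × Vel d =>
          σ p.1 p.2 * (M p.1 * (f p.2 * ψ p.2))]
        exact integral_sub gain loss.swap
    _ = _ := integral_congr_ae (ae_of_all _ fun p => by ring)

end WeakForm

theorem integrable_collision {C : ℝ} (hσ : Measurable (Function.uncurry σ))
    (hC : ∀ v v', |σ v v'| ≤ C) (hM : Integrable M) (hf : Integrable f) :
    Integrable (collision M σ f) := by
  simpa only [Pi.one_apply, mul_one] using integrable_collision_mul (ψ := 1) hσ hC hM hf
    (by simpa only [Pi.one_apply, mul_one]) (by simpa only [Pi.one_apply, mul_one])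

theorem collision_congr_ae (hfF : f =ᵐ[volume] F) :
    collision M σ f =ᵐ[volume] collision M σ F := by
  filter_upwards [hfF] with v hv
  refine integral_congr_ae ?_
  filter_upwards [hfF] with v' hv'
  rw [hv, hv']

theorem le_collision {ν C : ℝ} (hσ : Measurable (Function.uncurry σ)) (hle : ∀ v v', ν ≤ σ v v')
    (hC : ∀ v v', |σ v v'| ≤ C) (hM : ∀ v, 0 ≤ M v) (hM1 : ∫ v, M v = 1)
    (hF : ∀ᵐ v, 0 ≤ F v) (hF1 : ∫ v, F v = 1) :
    ∀ᵐ v, ν * M v - C * F v ≤ collision M σ F v := by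
  have hMi : Integrable M := integrable_of_integral_eq_one hM1
  have hFi : Integrable F := integrable_of_integral_eq_one hF1
  filter_upwards [hF] with v hv
  have gain : Integrable fun v' => σ v v' * M v * F v' := by
    simpa only [mul_assoc, Function.comp_apply, Function.uncurry_apply_pair] using
      (hFi.const_mul (M v)).bdd_mul (hσ.comp measurable_prodMk_left).aestronglyMeasurable
        (ae_of_all _ (hC v))
  have loss : Integrable fun v' => σ v' v * M v' * F v :=
    (hMi.bdd_mul (hσ.comp measurable_prodMk_right).aestronglyMeasurable
      (ae_of_all _ fun v' => hC v' v)).mul_const (F v)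
  calc ν * M v - C * F v = ∫ v', (ν * M v * F v' - C * M v' * F v) := by
        rw [integral_sub (hFi.const_mul _) ((hMi.const_mul _).mul_const _), integral_const_mul,
          integral_mul_const, integral_const_mul, hF1, hM1, mul_one, mul_one]
    _ ≤ collision M σ F v := by
        refine integral_mono_ae ((hFi.const_mul _).sub ((hMi.const_mul _).mul_const _))
          (gain.sub loss) ?_
        filter_upwards [hF] with v' hv'
        have := hM v
        have := hM v'
        gcongr
        exacts [hle v v', le_of_abs_le (hC v' v)]

/-- The entropy dissipated by collisions, for the density `h` relative to the steady state `F`. -/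
noncomputable def dissipation (M : Vel d → ℝ) (σ : Vel d → Vel d → ℝ) (F h : Vel d → ℝ) : ℝ :=
  2⁻¹ * ∫ p : Vel d × Vel d, σ p.1 p.2 * (M p.1 * F p.2) * (h p.1 - h p.2) ^ 2 ∂volume.prod volume

section Dissipation

variable {C : ℝ} (hσ : Measurable (Function.uncurry σ)) (hC : ∀ v v', |σ v v'| ≤ C)
  (hM : Integrable M) (hF : Integrable F) (hh : AEStronglyMeasurable h volume)
  (hMh : Integrable fun v => M v * h v ^ 2) (hFh : Integrable fun v => F v * h v ^ 2)
include hσ hC hM hF hh hMh hFh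

theorem integrable_collision_mul_self : Integrable fun v => collision M σ (F * h) v * h v :=
  integrable_collision_mul hσ hC hM (integrable_mul_of_sq hF hh hFh)
    (integrable_mul_of_sq hM hh hMh) (by simpa only [Pi.mul_apply, mul_assoc, sq] using hFh)

theorem integrable_dissipation :
    Integrable (fun p : Vel d × Vel d => σ p.1 p.2 * (M p.1 * F p.2) * (h p.1 - h p.2) ^ 2)
      (volume.prod volume) := by
  have hMh1 := integrable_mul_of_sq hM hh hMh
  have hFh1 := integrable_mul_of_sq hF hh hFh
  refine (((integrable_kernel_mul hσ hC hMh hF).sub ((integrable_kernel_mul hσ hC hMh1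
    hFh1).const_mul 2)).add (integrable_kernel_mul hσ hC hM hFh)).congr (ae_of_all _ fun p => ?_)
  simp only [Pi.add_apply, Pi.sub_apply]
  ring

theorem dissipation_eq :
    dissipation M σ F h =
      2⁻¹ * (∫ v, collision M σ F v * h v ^ 2) - ∫ v, collision M σ (F * h) v * h v := by
  have hMh1 := integrable_mul_of_sq hM hh hMh
  have hFh1 : Integrable (F * h) := integrable_mul_of_sq hF hh hFh
  have hFhh : Integrable fun v => (F * h) v * h v := by
    simpa only [Pi.mul_apply, mul_assoc, sq] using hFh
  rw [integral_collision_mul hσ hC hM hF hMh hFh, integral_collision_mul hσ hC hM hFh1 hMh1 hFhh,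
    dissipation, ← integral_const_mul, ← integral_const_mul,
    ← integral_sub ((integrable_collision_kernel hσ hC hM hF hMh hFh).const_mul _)
      (integrable_collision_kernel hσ hC hM hFh1 hMh1 hFhh)]
  refine integral_congr_ae (ae_of_all _ fun p => ?_)
  simp only [Pi.mul_apply]
  ring

end Dissipation

theorem integral_mul_sub_div_sq (hFpos : ∀ᵐ v, 0 < F v) (c : ℝ) :
    ∫ v, F v * (c - f v / F v) ^ 2 = normL2Inv F (fun v => f v - c * F v) ^ 2 := by
  rw [normL2Inv_sq hFpos]
  refine integral_congr_ae ?_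
  filter_upwards [hFpos] with v hv
  rw [sq_abs]
  field_simp
  ring

section Coercivity

variable (hM0 : ∀ v, 0 ≤ M v) (hM1 : ∫ v, M v = 1) (hFpos : ∀ᵐ v, 0 < F v) (hF1 : ∫ v, F v = 1)
  (hf : MemL2Inv F f)
include hM0 hM1 hFpos hF1 hf

theorem normL2Inv_sub_massDensity_mul_sq_le_integral_prod
    (hi : Integrable (fun p : Vel d × Vel d => M p.1 * F p.2 *
      (f p.1 / F p.1 - f p.2 / F p.2) ^ 2) (volume.prod volume)) :
    normL2Inv F (fun v => f v - massDensity f * F v) ^ 2 ≤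
      ∫ p : Vel d × Vel d, M p.1 * F p.2 * (f p.1 / F p.1 - f p.2 / F p.2) ^ 2
        ∂volume.prod volume := by
  have hM : Integrable M := integrable_of_integral_eq_one hM1
  have hF : Integrable F := integrable_of_integral_eq_one hF1
  have inner (v : Vel d) : ∫ v', M v * F v' * (f v / F v - f v' / F v') ^ 2 =
      M v * normL2Inv F (fun v' => f v' - f v / F v * F v') ^ 2 := by
    simp only [mul_assoc, integral_const_mul, integral_mul_sub_div_sq hFpos]
  have outer := hi.integral_prod_left
  simp only [integral_prod _ hi, inner] at outer ⊢
  set N := normL2Inv F (fun v => f v - massDensity f * F v) ^ 2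
  calc N = ∫ v, M v * N := by rw [integral_mul_const, hM1, one_mul]
    _ ≤ _ := integral_mono (hM.mul_const N) outer fun v => mul_le_mul_of_nonneg_left
      (hf.normL2Inv_sub_massDensity_mul_sq_le hF hFpos _ hF1) (hM0 v)

theorem le_dissipation {ν C : ℝ} (hσ : Measurable (Function.uncurry σ)) (hν : 0 ≤ ν)
    (hle : ∀ v v', ν ≤ σ v v') (hC : ∀ v v', |σ v v'| ≤ C)
    (hMf : Integrable fun v => M v * (f v / F v) ^ 2) :
    ν / 2 * normL2Inv F (fun v => f v - massDensity f * F v) ^ 2 ≤ dissipation M σ F (f / F) := by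
  have hM : Integrable M := integrable_of_integral_eq_one hM1
  have hF : Integrable F := integrable_of_integral_eq_one hF1
  have hh : AEStronglyMeasurable (f / F) volume := hf.1.div₀ hF.1
  have hi := integrable_dissipation hσ hC hM hF hh hMf hf.integrable_mul_div_sq
  have hi₁ := integrable_dissipation (σ := 1) (C := 1) measurable_const
    (fun _ _ => by simp only [Pi.one_apply, abs_one, le_refl]) hM hF hh hMf hf.integrable_mul_div_sq
  simp only [Pi.one_apply, one_mul] at hi₁
  set N := normL2Inv F (fun v => f v - massDensity f * F v) ^ 2
  calc ν / 2 * N = 2⁻¹ * (ν * N) := by ring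
    _ ≤ 2⁻¹ * (ν * ∫ p : Vel d × Vel d,
        M p.1 * F p.2 * (f p.1 / F p.1 - f p.2 / F p.2) ^ 2 ∂volume.prod volume) := by
      gcongr
      exact normL2Inv_sub_massDensity_mul_sq_le_integral_prod hM0 hM1 hFpos hF1 hf hi₁
    _ = 2⁻¹ * ∫ p : Vel d × Vel d,
        ν * (M p.1 * F p.2 * (f p.1 / F p.1 - f p.2 / F p.2) ^ 2) ∂volume.prod volume := by
      rw [integral_const_mul]
    _ ≤ dissipation M σ F (f / F) := by
      refine mul_le_mul_of_nonneg_left (integral_mono_ae (hi₁.const_mul ν) hi ?_) (by norm_num)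
      filter_upwards [Measure.quasiMeasurePreserving_snd.ae hFpos] with p hp
      have := hM0 p.1
      simp only [Pi.div_apply, mul_assoc]
      gcongr
      exact hle _ _

end Coercivity

end

/-! ### Lower bound for the modified equilibrium -/

section

variable {d : ℕ} {E : Vel d} {α : ℝ} {M F : Vel d → ℝ} {σ : Vel d → Vel d → ℝ}

theorem norm_add_le_exp_mul {V W : Type*} [NormedAddCommGroup V] [NormedSpace ℝ V]
    [NormedAddCommGroup W] [NormedSpace ℝ W] {f : V → W} {C : ℝ} (hf : Differentiable ℝ f)
    (hC : ∀ v, ‖fderiv ℝ f v‖ ≤ C * ‖f v‖) (v w : V) :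
    ‖f (v + w)‖ ≤ Real.exp (C * ‖w‖) * ‖f v‖ := by
  have hder (t : ℝ) : HasDerivAt (fun t : ℝ => f (v + t • w)) (fderiv ℝ f (v + t • w) w) t := by
    have := (hf (v + t • w)).hasFDerivAt.comp_hasDerivAt_of_eq t
      (((hasDerivAt_id' t).smul_const w).const_add v) rfl
    simpa only [one_smul, Function.comp_def] using this
  have := norm_le_gronwallBound_of_norm_deriv_right_le (a := 0) (b := 1) (K := C * ‖w‖) (ε := 0)
    (fun t _ => (hder t).continuousAt.continuousWithinAt)
    (fun t _ => (hder t).hasDerivWithinAt) le_rfl (fun t _ => ?_) 1 (by simp)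
  · simpa only [gronwallBound_ε0, zero_smul, add_zero, one_smul, sub_zero, mul_one, mul_comm]
      using this
  · calc ‖fderiv ℝ f (v + t • w) w‖ ≤ ‖fderiv ℝ f (v + t • w)‖ * ‖w‖ :=
        (fderiv ℝ f (v + t • w)).le_opNorm _
      _ ≤ C * ‖f (v + t • w)‖ * ‖w‖ := by gcongr; exact hC _
      _ = C * ‖w‖ * ‖f (v + t • w)‖ + 0 := by ring

theorem IsHeavyTailed.exists_mul_le_translate (hM : IsHeavyTailed α M) (E : Vel d) :
    ∃ c > 0, ∀ s ∈ Set.Ico (-1 : ℝ) 0, ∀ v, c * M v ≤ M (s • E + v) := by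
  obtain ⟨C, hC⟩ := hM.norm_fderiv_le
  have hC0 : 0 ≤ C := by
    have := (norm_nonneg _).trans (hC 0)
    exact nonneg_of_mul_nonneg_left this (by simpa using hM.pos 0)
  have hMC (v : Vel d) : ‖fderiv ℝ M v‖ ≤ C * ‖M v‖ := by
    rw [Real.norm_of_nonneg (hM.pos v).le]
    exact (hC v).trans (mul_le_mul_of_nonneg_left
      (div_le_self (hM.pos v).le (by linarith [norm_nonneg v])) hC0)
  refine ⟨Real.exp (-(C * ‖E‖)), Real.exp_pos _, fun s hs v => ?_⟩
  have hs1 : ‖s‖ ≤ 1 := abs_le.2 ⟨hs.1, hs.2.le.trans zero_le_one⟩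
  have hsE : ‖-(s • E)‖ ≤ ‖E‖ := by
    rw [norm_neg, norm_smul]
    exact mul_le_of_le_one_left (norm_nonneg E) hs1
  have harnack := norm_add_le_exp_mul hM.differentiable hMC (s • E + v) (-(s • E))
  rw [add_neg_cancel_comm, Real.norm_of_nonneg (hM.pos _).le, Real.norm_of_nonneg (hM.pos _).le]
    at harnack
  rw [Real.exp_neg, inv_mul_le_iff₀ (Real.exp_pos _)]
  refine harnack.trans (mul_le_mul_of_nonneg_right ?_ (hM.pos _).le)
  gcongr

theorem IsCrossSection.measurable_uncurry (hσ : IsCrossSection M σ) :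
    Measurable (Function.uncurry σ) :=
  measurable_uncurry_of_continuous_of_measurable
    (fun v => by simpa only [hσ.symm _ v] using (hσ.differentiable v).continuous)
    fun v => (hσ.differentiable v).continuous.measurable

theorem IsModifiedEquilibrium.exists_mul_le {ν C c : ℝ} (hσ : Measurable (Function.uncurry σ))
    (hν : 0 < ν) (hle : ∀ v v', ν ≤ σ v v') (hC : ∀ v v', |σ v v'| ≤ C) (hM0 : ∀ v, 0 ≤ M v)
    (hM1 : ∫ v, M v = 1) (hc : 0 < c)
    (hMc : ∀ s ∈ Set.Ico (-1 : ℝ) 0, ∀ v, c * M v ≤ M (s • E + v))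
    (hF : IsModifiedEquilibrium M σ E F) : ∃ κ > 0, ∀ᵐ v, κ * M v ≤ F v := by
  have hC0 : 0 < C := hν.trans_le ((hle 0 0).trans (le_of_abs_le (hC 0 0)))
  have hMi : Integrable M := integrable_of_integral_eq_one hM1
  have hFi : Integrable F := integrable_of_integral_eq_one hF.integral_eq_one
  have hF0 : ∀ᵐ v, 0 ≤ F v := hF.pos.mono fun _ => le_of_lt
  have hcoll := le_collision hσ hle hC hM0 hM1 hF0 hF.integral_eq_one
  refine ⟨(1 - Real.exp (-C)) / C * (ν * c), ?_, ?_⟩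
  · have := sub_pos.2 (Real.exp_lt_one_iff.2 (neg_neg_of_pos hC0))
    positivity
  · simp only [mul_assoc _ (ν * c)]
    refine hF.equation.ae_mul_le hC0 hFi (integrable_collision hσ hC hMi hFi) (hMi.const_mul _)
      hF0 fun s hs => ?_
    filter_upwards [(measurePreserving_add_left volume (s • E)).quasiMeasurePreserving.ae hcoll]
      with v hv
    linarith [mul_le_mul_of_nonneg_left (hMc s hs v) hν.le]

end

/-! ### The entropy inequality -/

section EntropyIdentity

variable {d : ℕ} {E : Vel d} {κ C : ℝ} {M f F : Vel d → ℝ} {σ : Vel d → Vel d → ℝ}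
  (hσ : Measurable (Function.uncurry σ)) (hC : ∀ v v', |σ v v'| ≤ C) (hM0 : ∀ v, 0 < M v)
  (hM : Integrable M) (hκ : 0 < κ) (hκF : ∀ᵐ v, κ * M v ≤ F v)
  (hF : IsModifiedEquilibrium M σ E F) (hf : InDomain M E f)
include hσ hC hM0 hM hκ hκF hF hf

theorem integrable_and_integral_transportCollision_mul_div :
    Integrable (fun v => transportCollision M σ E f v * (f v / F v)) ∧
      ∫ v, transportCollision M σ E f v * (f v / F v) = dissipation M σ F (f / F) := by
  obtain ⟨hfM, g, hfg, hgM⟩ := hf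
  have hFi : Integrable F := integrable_of_integral_eq_one hF.integral_eq_one
  have hF0 : ∀ᵐ v, F v ≠ 0 := hF.pos.mono fun _ => ne_of_gt
  have hfF := hfM.of_mul_le hκ (ae_of_all _ hM0) hFi.1 hκF
  have hgF := hgM.of_mul_le hκ (ae_of_all _ hM0) hFi.1 hκF
  have hh : AEStronglyMeasurable (f / F) volume := hfF.1.div₀ hFi.1
  have hMh : Integrable fun v => M v * (f / F) v ^ 2 :=
    hfF.integrable_mul_div_sq_of_mul_le hκ hFi.1 hM.1 (ae_of_all _ fun v => (hM0 v).le) hκF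
  have hFh : Integrable fun v => F v * (f / F) v ^ 2 := hfF.integrable_mul_div_sq
  have transport : Integrable fun v => f v / F v * g v := by
    simpa only [mul_div_right_comm] using hfF.integrable_mul_div hFi.1 hgF
  have coll := integrable_collision_mul_self hσ hC hM hFi hh hMh hFh
  have byParts := hfg.two_mul_integral_div_mul (hfF.integrable hFi hF0) (hgF.integrable hFi hF0)
    hFi (integrable_collision hσ hC hM hFi) hF.equation hF.pos transport
    (by simpa only [Pi.div_apply, mul_comm] using integrable_collision_mul hσ hC hM hFi hMh hFh)
  have hFf : f =ᵐ[volume] F * (f / F) :=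
    hF0.mono fun v hv => (mul_div_cancel₀ _ hv).symm
  have hT : (fun v => transportCollision M σ E f v * (f v / F v)) =ᵐ[volume]
      fun v => f v / F v * g v - collision M σ (F * (f / F)) v * (f / F) v := by
    filter_upwards [hfg.weakDirDeriv_ae_eq, collision_congr_ae (M := M) (σ := σ) hFf] with v hg hQ
    rw [transportCollision, hg, hQ, Pi.div_apply]
    ring
  refine ⟨(transport.sub coll).congr hT.symm, ?_⟩
  rw [integral_congr_ae hT, integral_sub transport coll, dissipation_eq hσ hC hM hFi hh hMh hFh]
  simp only [Pi.div_apply, mul_comm (collision M σ F _), ← byParts]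
  ring

end EntropyIdentity

end LinearBoltzmann

open LinearBoltzmann in
theorem proposition2p9_general {d : ℕ} {E : Vel d} {ν₁ ν₂ c : ℝ} {M f F : Vel d → ℝ}
    {σ : Vel d → Vel d → ℝ} (hM0 : ∀ v, 0 < M v) (hM1 : ∫ v, M v = 1) (hc : 0 < c)
    (hMc : ∀ s ∈ Set.Ico (-1 : ℝ) 0, ∀ v, c * M v ≤ M (s • E + v))
    (hσ : Measurable (Function.uncurry σ)) (hν : 0 < ν₁)
    (hσb : ∀ v v', ν₁ ≤ σ v v' ∧ σ v v' ≤ ν₂)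
    (hF : IsModifiedEquilibrium M σ E F) (hf : InDomain M E f) :
Integrable (fun v => transportCollision M σ E f v * (f v / F v)) ∧
      MemL2Inv F f ∧ MemL2Inv F (fun v => f v - massDensity f * F v) ∧
      ν₁ / 2 * normL2Inv F (fun v => f v - massDensity f * F v) ^ 2 ≤
        ∫ v, transportCollision M σ E f v * (f v / F v) := by
  have hle (v v' : Vel d) : ν₁ ≤ σ v v' := (hσb v v').1
  have hC (v v' : Vel d) : |σ v v'| ≤ ν₂ :=
    abs_le.2 ⟨by linarith [(hσb v v').1, (hσb v v').2], (hσb v v').2⟩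
  have hM : Integrable M := integrable_of_integral_eq_one hM1
  have hFi : Integrable F := integrable_of_integral_eq_one hF.integral_eq_one
  have hM0' (v : Vel d) : 0 ≤ M v := (hM0 v).le
  obtain ⟨κ, hκ, hκF⟩ := hF.exists_mul_le hσ hν hle hC hM0' hM1 hc hMc
  have hfF : MemL2Inv F f := hf.1.of_mul_le hκ (ae_of_all _ hM0) hFi.1 hκF
  obtain ⟨hTi, hT⟩ :=
    integrable_and_integral_transportCollision_mul_div hσ hC hM0 hM hκ hκF hF hf
  refine ⟨hTi, hfF, hfF.sub_const_mul hFi hF.pos _, hT ▸ ?_⟩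
  exact le_dissipation hM0' hM1 hF.pos hF.integral_eq_one hfF hσ hν.le hle hC
    (hfF.integrable_mul_div_sq_of_mul_le hκ hFi.1 hM.1 (ae_of_all _ hM0') hκF)

theorem proposition2p9 {d : ℕ} (α : ℝ)
    (M : LinearBoltzmann.Vel d → ℝ)
    (σ : LinearBoltzmann.Vel d → LinearBoltzmann.Vel d → ℝ)
    (hM : LinearBoltzmann.IsHeavyTailed α M)
    (hσ : LinearBoltzmann.IsCrossSection M σ) :
    (∀ (E : LinearBoltzmann.Vel d) (F : LinearBoltzmann.Vel d → ℝ),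
      LinearBoltzmann.IsModifiedEquilibrium M σ E F →
      ∀ f : LinearBoltzmann.Vel d → ℝ, LinearBoltzmann.InDomain M E f →
        Integrable
          (fun v => LinearBoltzmann.transportCollision M σ E f v * (f v / F v)) volume ∧
        0 ≤ ∫ v, LinearBoltzmann.transportCollision M σ E f v * (f v / F v)) ∧
    (∀ R : ℝ, 0 < R → ∃ θ : ℝ, 0 < θ ∧
      ∀ E : LinearBoltzmann.Vel d, ‖E‖ ≤ R →
      ∀ F : LinearBoltzmann.Vel d → ℝ, LinearBoltzmann.IsModifiedEquilibrium M σ E F →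
      ∀ f : LinearBoltzmann.Vel d → ℝ, LinearBoltzmann.InDomain M E f →
        LinearBoltzmann.MemL2Inv F f ∧
        LinearBoltzmann.MemL2Inv F (fun v => f v - LinearBoltzmann.massDensity f * F v) ∧
        θ * LinearBoltzmann.normL2Inv F
              (fun v => f v - LinearBoltzmann.massDensity f * F v) ^ 2 ≤
          ∫ v, LinearBoltzmann.transportCollision M σ E f v * (f v / F v)) := by
  obtain ⟨ν₁, ν₂, hν₁, hσb⟩ := hσ.bounds
  choose c hc hMc using hM.exists_mul_le_translate
  have key (E F f) (hF : LinearBoltzmann.IsModifiedEquilibrium M σ E F)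
      (hf : LinearBoltzmann.InDomain M E f) :=
    proposition2p9_general hM.pos hM.integral_eq_one (hc E) (hMc E)
      hσ.measurable_uncurry hν₁ hσb hF hf
  exact ⟨fun E F hF f hf => ⟨(key E F f hF hf).1, le_trans (by positivity) (key E F f hF hf).2.2.2⟩,
    fun R _ => ⟨ν₁ / 2, half_pos hν₁, fun E _ F hF f hf => (key E F f hF hf).2⟩⟩
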